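/- Let $H$ be a finite-dimensional complex Hilbert space and let $A,B$ be positive definite operators on $H$. For $\gamma\in\mathbb{R}$ and self-adjoint operators $X,Y$ on $H$ let $$E_\gamma(X\|Y):=\operatorname{Tr}\big[(X-\gamma Y)_+\big]$$ be the hockey-stick divergence, where $Z_+$ denotes the positive part of a self-adjoint operator $Z$, and let $$D(A\|B):=\operatorname{Tr}\big[A(\log A-\log B)\big]$$ be the Umegaki relative entropy ($\log$ being the natural logarithm, applied by functional calculus). Then the integral below converges absolutely and $$D(A\|B)=\int_1^\infty\Big(\frac1\gamma E_\gamma(A\|B)+\frac1{\gamma^2}E_\gamma(B\|A)\Big)\,d\gamma+\operatorname{Tr}[A-B].$$ -/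

import Mathlib

noncomputable section

namespace QuantumDivergence

variable {H : Type*} [NormedAddCommGroup H] [InnerProductSpace ℂ H] [FiniteDimensional ℂ H]

/-- The trace of an operator on a finite-dimensional complex Hilbert space. -/
def tr (A : H →L[ℂ] H) : ℂ := LinearMap.trace ℂ H (A : H →ₗ[ℂ] H)

/-- `A` is positive definite: `A` is self-adjoint and `⟪x, A x⟫ > 0` for every `x ≠ 0`. -/
def IsPosDef (A : H →L[ℂ] H) : Prop :=
  IsSelfAdjoint A ∧ ∀ x : H, x ≠ 0 → 0 < (inner ℂ x (A x)).re

/-- The hockey-stick divergence `E_γ(A‖B) = Tr[(A - γ B)₊]`, where `X₊` is the positive part of the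
self-adjoint operator `X` (functional calculus for `t ↦ max t 0`). The trace is real, so its real part is the trace itself. -/
def hockeyStick (γ : ℝ) (A B : H →L[ℂ] H) : ℝ := (tr (A - (γ : ℂ) • B)⁺).re

/-- The Umegaki relative entropy `D(A‖B) = Tr[A (log A - log B)]`, with the logarithm given by
functional calculus. The trace of a product of two self-adjoint operators is real, so its real part
is the trace itself. -/
def relativeEntropy (A B : H →L[ℂ] H) : ℝ := (tr (A * (CFC.log A - CFC.log B))).re

end QuantumDivergence

end

open MeasureTheory QuantumDivergence

/-! Both sides come from one double integral, over a level `t > 1` and a shift `u > 0`, of the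
number of positive eigenvalues of `(A + u) - t (B + u) = A - t B - (t - 1) u`, weighted by `1 -
1/t`, plus the same with `A` and `B` exchanged, weighted by `1/t - 1/t²`.

Integrating over `u` first turns each count into `Tr[(A - tB)₊] / (t - 1)` or its mirror image, and
the weights become `1/t` and `1/t²`.

Integrating over `t` first, Sylvester's law replaces each count by one on the generalized
eigenvalues `m` of the pair `A + u`, `B + u`. The weights are the layer-cake densities of `f x = x -
1 - log x`, so the result is `∑ f (m k)`. This involves only the trace and the log-determinant,
which makes it a sum over pairs of eigenvalues `a i` of `A` and `b j` of `B`, weighted by the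
squared overlaps of the eigenvectors, although `A` and `B` need not commute. A scalar integral of `f
((a + u) / (b + u))` over `u` then yields `D(A‖B) - Tr[A - B]`.

Everything is nonnegative, so Tonelli applies (`lintegral_hockeyStick`). The carrying lemmas are
`exists_pencil_eigenvalues`, `lintegral_posIndex_sub_smul` and `lintegral_shift_entropy`. -/

/-! ### Scalar integrals -/

lemma sub_one_sub_log_nonneg {x : ℝ} (hx : 0 < x) : 0 ≤ x - 1 - Real.log x := by
  linarith [Real.log_le_sub_one_of_pos hx]

lemma scalar_entropy_nonneg {a b : ℝ} (ha : 0 < a) (hb : 0 < b) :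
    0 ≤ a * (Real.log a - Real.log b) - a + b := by
  have h := Real.log_le_sub_one_of_pos (div_pos hb ha)
  rw [Real.log_div hb.ne' ha.ne'] at h
  have h2 := mul_le_mul_of_nonneg_left h ha.le
  have h3 : a * (b / a - 1) = b - a := by field_simp
  linarith

/-- The scalar relative entropy as an integral of `f x = x - 1 - log x` along a shift. -/
lemma lintegral_shift_entropy {a b : ℝ} (ha : 0 < a) (hb : 0 < b) :
    ∫⁻ u in Set.Ioi (0 : ℝ),
        ENNReal.ofReal ((a + u) / (b + u) - 1 - Real.log ((a + u) / (b + u)))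
      = ENNReal.ofReal (a * (Real.log a - Real.log b) - a + b) := by
  -- Up to sign, the scalar relative entropy of `a + u` and `b + u`; it is an antiderivative of the
  -- integrand and vanishes at infinity.
  set F : ℝ → ℝ := fun u =>
    -((a + u) * (Real.log (a + u) - Real.log (b + u)) - a + b) with hF
  have hder : ∀ u ∈ Set.Ici (0 : ℝ), HasDerivAt F
      ((a + u) / (b + u) - 1 - Real.log ((a + u) / (b + u))) u := by
    intro u hu
    have hu : 0 ≤ u := hu
    have h1 : HasDerivAt (fun u : ℝ => a + u) 1 u := (hasDerivAt_id u).const_add a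
    have h2 : HasDerivAt (fun u : ℝ => b + u) 1 u := (hasDerivAt_id u).const_add b
    have ha' : a + u ≠ 0 := by positivity
    have hb' : b + u ≠ 0 := by positivity
    have h3 := (((h1.mul ((h1.log ha').sub (h2.log hb'))).sub_const a).add_const b).neg
    refine h3.congr_deriv ?_
    rw [Real.log_div ha' hb']
    simp only [Pi.sub_apply]
    field_simp
    ring
  have hnn : ∀ u ∈ Set.Ioi (0 : ℝ),
      0 ≤ (a + u) / (b + u) - 1 - Real.log ((a + u) / (b + u)) := fun u hu => by
    have hu : 0 < u := hu
    exact sub_one_sub_log_nonneg (by positivity)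
  have hlim : Filter.Tendsto F Filter.atTop (nhds 0) := by
    -- The bound `log x ≤ x - 1` at `x = (a + u) / (b + u)` squeezes `F` between this function and
    -- `0`.
    have hb0 : Filter.Tendsto (fun u : ℝ => -((a - b) ^ 2 / (b + u))) Filter.atTop (nhds 0) := by
      rw [← neg_zero]
      exact ((Filter.tendsto_atTop_add_const_left _ b Filter.tendsto_id).const_div_atTop _).neg
    refine tendsto_of_tendsto_of_tendsto_of_le_of_le' hb0 tendsto_const_nhds ?_ ?_
    · filter_upwards [Filter.eventually_gt_atTop 0] with u hu
      have ha' : 0 < a + u := by positivity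
      have hb' : 0 < b + u := by positivity
      have h := Real.log_le_sub_one_of_pos (div_pos ha' hb')
      rw [Real.log_div ha'.ne' hb'.ne'] at h
      have h2 := mul_le_mul_of_nonneg_left h ha'.le
      have h3 : (a + u) * ((a + u) / (b + u) - 1) - a + b = (a - b) ^ 2 / (b + u) := by
        field_simp
        ring
      simp only [hF]
      linarith
    · filter_upwards [Filter.eventually_gt_atTop 0] with u hu
      have ha' : 0 < a + u := by positivity
      have hb' : 0 < b + u := by positivity
      have h := scalar_entropy_nonneg ha' hb'
      simp only [hF]
      linarith
  have hc : ContinuousWithinAt F (Set.Ici 0) 0 :=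
    (hder 0 Set.self_mem_Ici).continuousAt.continuousWithinAt
  have hder' := fun u (hu : u ∈ Set.Ioi (0 : ℝ)) => hder u (Set.Ioi_subset_Ici_self hu)
  rw [← ofReal_integral_eq_lintegral_ofReal
    (integrableOn_Ioi_deriv_of_nonneg hc hder' hnn hlim)
    ((ae_restrict_mem measurableSet_Ioi).mono hnn),
    integral_Ioi_of_hasDerivAt_of_nonneg hc hder' hnn hlim]
  congr 1
  simp [hF]

lemma lintegral_Ioi_one_weight_aux {w W : ℝ → ℝ} {y : ℝ} (hy : 1 ≤ y)
    (hW : ∀ t, 1 ≤ t → HasDerivAt W (w t) t) (hw : ∀ t, 1 ≤ t → 0 ≤ w t)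
    (hwc : ContinuousOn w (Set.Icc 1 y)) :
    ∫⁻ t in Set.Ioc 1 y, ENNReal.ofReal (w t) = ENNReal.ofReal (W y - W 1) := by
  have hint : IntervalIntegrable w volume 1 y :=
    ContinuousOn.intervalIntegrable (by rwa [Set.uIcc_of_le hy])
  rw [← ofReal_integral_eq_lintegral_ofReal
    ((intervalIntegrable_iff_integrableOn_Ioc_of_le hy).mp hint)
    ((ae_restrict_mem measurableSet_Ioc).mono fun t ht => hw t ht.1.le),
    ← intervalIntegral.integral_of_le hy,
    intervalIntegral.integral_eq_sub_of_hasDerivAt (fun t ht => hW t ?_) hint]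
  rw [Set.uIcc_of_le hy] at ht
  exact ht.1

lemma lintegral_ite_lt {w : ℝ → ℝ} {y : ℝ} :
    ∫⁻ t in Set.Ioi (1 : ℝ), (if t < y then ENNReal.ofReal (w t) else 0)
      = ∫⁻ t in Set.Ioc 1 y, ENNReal.ofReal (w t) := by
  have : (fun t : ℝ => if t < y then ENNReal.ofReal (w t) else 0)
      = (Set.Iio y).indicator fun t => ENNReal.ofReal (w t) := by
    ext t; simp [Set.indicator]
  rw [this, setLIntegral_indicator measurableSet_Iio, Set.inter_comm, Set.Ioi_inter_Iio]
  exact setLIntegral_congr Ioo_ae_eq_Ioc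

lemma lintegral_ite_lt_sub_inv (y : ℝ) :
    ∫⁻ t in Set.Ioi (1 : ℝ), (if t < y then ENNReal.ofReal (1 - t⁻¹) else 0)
      = if 1 ≤ y then ENNReal.ofReal (y - 1 - Real.log y) else 0 := by
  rw [lintegral_ite_lt]
  split_ifs with hy
  · rw [lintegral_Ioi_one_weight_aux (W := fun t => t - Real.log t) hy]
    · simp; congr 1; ring
    · intro t ht
      exact (hasDerivAt_id t).sub (Real.hasDerivAt_log (by positivity))
    · intro t ht
      linarith [inv_le_one_of_one_le₀ ht]
    · refine continuousOn_const.sub (continuousOn_inv₀.mono fun t ht => ?_)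
      have := ht.1
      simp; positivity
  · rw [Set.Ioc_eq_empty (by linarith)]; simp

lemma lintegral_ite_lt_inv_sub (y : ℝ) :
    ∫⁻ t in Set.Ioi (1 : ℝ), (if t < y then ENNReal.ofReal (t⁻¹ - (t ^ 2)⁻¹) else 0)
      = if 1 ≤ y then ENNReal.ofReal (Real.log y + y⁻¹ - 1) else 0 := by
  rw [lintegral_ite_lt]
  split_ifs with hy
  · rw [lintegral_Ioi_one_weight_aux (W := fun t => Real.log t + t⁻¹) hy]
    · simp
    · intro t ht
      exact ((Real.hasDerivAt_log (by positivity)).add (hasDerivAt_inv (by positivity)))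
    · intro t ht
      have := inv_anti₀ (by positivity) (by nlinarith : t ≤ t ^ 2)
      linarith
    · have h0 : ∀ t ∈ Set.Icc 1 y, t ≠ 0 := fun t ht => by have := ht.1; positivity
      exact (continuousOn_id.inv₀ h0).sub
        ((continuousOn_id.pow 2).inv₀ fun t ht => pow_ne_zero 2 (h0 t ht))
  · rw [Set.Ioc_eq_empty (by linarith)]; simp

/-- Layer-cake representation of `x - 1 - log x`. -/
lemma lintegral_layer_cake_entropy {x : ℝ} (hx : 0 < x) :
    ∫⁻ t in Set.Ioi (1 : ℝ), ((if t < x then ENNReal.ofReal (1 - t⁻¹) else 0)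
        + (if t * x < 1 then ENNReal.ofReal (t⁻¹ - (t ^ 2)⁻¹) else 0))
      = ENNReal.ofReal (x - 1 - Real.log x) := by
  have hm : Measurable fun t : ℝ => if t < x then ENNReal.ofReal (1 - t⁻¹) else 0 :=
    Measurable.ite measurableSet_Iio (by fun_prop) measurable_const
  rw [lintegral_add_left hm, lintegral_ite_lt_sub_inv]
  have hlt : ∀ t : ℝ, t * x < 1 ↔ t < x⁻¹ := fun t => by rw [← lt_div_iff₀ hx, one_div]
  simp_rw [hlt]
  rw [lintegral_ite_lt_inv_sub]
  -- Only the first term contributes for `x > 1`, only the second for `x < 1`, and neither at `x =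
  -- 1`.
  rcases lt_trichotomy x 1 with h | h | h
  · rw [if_neg (by linarith), if_pos (one_le_inv_iff₀.mpr ⟨hx, h.le⟩)]
    simp; congr 1; ring
  · subst h; simp
  · rw [if_pos h.le, if_neg (by simpa [one_le_inv_iff₀] using fun _ => h)]
    simp

/-! ### Operators diagonal in an orthonormal basis -/

namespace QuantumDivergence

variable {H : Type*} [NormedAddCommGroup H] [InnerProductSpace ℂ H]
  {ι κ : Type*} [Fintype ι] [Fintype κ]

/-- The operator `T` is diagonal in the orthonormal basis `e`, with real eigenvalues `μ`. -/
def IsDiag (e : OrthonormalBasis ι ℂ H) (μ : ι → ℝ) (T : H →L[ℂ] H) : Prop :=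
  ∀ i, T (e i) = (μ i : ℂ) • e i

/-- The operator which is diagonal in the orthonormal basis `e`, with eigenvalues `μ`. -/
noncomputable def diagOp (e : OrthonormalBasis ι ℂ H) (μ : ι → ℝ) : H →L[ℂ] H :=
  ∑ j, (μ j : ℂ) • (innerSL ℂ (e j)).smulRight (e j)

lemma diagOp_isDiag (e : OrthonormalBasis ι ℂ H) (μ : ι → ℝ) : IsDiag e μ (diagOp e μ) := by
  classical
  intro i
  simp [diagOp, OrthonormalBasis.inner_eq_ite]

lemma ext_basis (e : OrthonormalBasis ι ℂ H) {S T : H →L[ℂ] H} (h : ∀ i, S (e i) = T (e i)) :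
    S = T := by
  have : (S : H →ₗ[ℂ] H) = T := e.toBasis.ext fun i => by simpa using h i
  exact ContinuousLinearMap.coe_injective this

namespace IsDiag

variable {e : OrthonormalBasis ι ℂ H} {μ ν : ι → ℝ} {S T : H →L[ℂ] H}

lemma add (hS : IsDiag e μ S) (hT : IsDiag e ν T) : IsDiag e (fun i => μ i + ν i) (S + T) := by
  intro i
  simp [hS i, hT i, add_smul]

lemma mul (hS : IsDiag e μ S) (hT : IsDiag e ν T) : IsDiag e (fun i => μ i * ν i) (S * T) := by
  intro i
  rw [mul_apply_eq_comp, hT i, map_smul, hS i, smul_smul, Complex.ofReal_mul, mul_comm]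

lemma smul_one (e : OrthonormalBasis ι ℂ H) (c : ℝ) :
    IsDiag e (fun _ => c) ((c : ℂ) • (1 : H →L[ℂ] H)) := by
  intro i
  simp

lemma eq_diagOp (hT : IsDiag e μ T) : T = diagOp e μ :=
  ext_basis e fun i => by rw [hT i, diagOp_isDiag e μ i]

lemma inner_apply (hT : IsDiag e μ T) (x : H) (i : ι) :
    inner ℂ (e i) (T x) = μ i * inner ℂ (e i) x := by
  classical
  rw [hT.eq_diagOp]
  simp [diagOp, OrthonormalBasis.inner_eq_ite]

lemma inner_self (hT : IsDiag e μ T) (x : H) :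
    inner ℂ x (T x) = ((∑ i, μ i * ‖inner ℂ (e i) x‖ ^ 2 : ℝ) : ℂ) := by
  rw [← e.sum_inner_mul_inner]
  push_cast
  refine Finset.sum_congr rfl fun i _ => ?_
  rw [hT.inner_apply, ← inner_conj_symm x (e i), mul_left_comm, ← Complex.conj_mul']

lemma re_inner_self (hT : IsDiag e μ T) (x : H) :
    (inner ℂ x (T x)).re = ∑ i, μ i * ‖inner ℂ (e i) x‖ ^ 2 := by
  rw [hT.inner_self, Complex.ofReal_re]

lemma tr_mul (hT : IsDiag e μ T) {f : OrthonormalBasis κ ℂ H} {ν : κ → ℝ} (hS : IsDiag f ν S) :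
    tr (T * S) = ((∑ i, ∑ j, ‖inner ℂ (f j) (e i)‖ ^ 2 * (μ i * ν j) : ℝ) : ℂ) := by
  rw [tr, LinearMap.trace_eq_sum_inner _ e]
  push_cast
  refine Finset.sum_congr rfl fun i _ => ?_
  have := hT.inner_apply (S (e i)) i
  change inner ℂ (e i) (T (S (e i))) = _
  rw [this, hS.inner_self]
  push_cast
  rw [Finset.mul_sum]
  exact Finset.sum_congr rfl fun j _ => by ring

lemma tr_eq (hT : IsDiag e μ T) : tr T = ((∑ i, μ i : ℝ) : ℂ) := by
  rw [tr, LinearMap.trace_eq_sum_inner _ e]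
  push_cast
  refine Finset.sum_congr rfl fun i _ => ?_
  change inner ℂ (e i) (T (e i)) = _
  rw [hT.inner_apply]
  simp

lemma det_eq (hT : IsDiag e μ T) :
    LinearMap.det (T : H →ₗ[ℂ] H) = ((∏ i, μ i : ℝ) : ℂ) := by
  classical
  rw [← LinearMap.det_toMatrix e.toBasis]
  have : LinearMap.toMatrix e.toBasis e.toBasis (T : H →ₗ[ℂ] H)
      = Matrix.diagonal fun i => (μ i : ℂ) := by
    ext i j
    rw [LinearMap.toMatrix_apply, OrthonormalBasis.coe_toBasis_repr_apply,
      OrthonormalBasis.repr_apply_apply, OrthonormalBasis.coe_toBasis]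
    change inner ℂ (e i) (T (e j)) = _
    rw [hT.inner_apply, OrthonormalBasis.inner_eq_ite, Matrix.diagonal_apply]
    simp
  rw [this, Matrix.det_diagonal]
  push_cast
  rfl

lemma spectrum_subset (hT : IsDiag e μ T) : spectrum ℝ T ⊆ Set.range μ := by
  intro x hx
  by_contra hne
  refine hx ?_
  have h1 : ∀ i, x - μ i ≠ 0 := fun i h => hne ⟨i, (sub_eq_zero.mp h).symm⟩
  have hd : IsDiag e (fun i => x - μ i) (algebraMap ℝ (H →L[ℂ] H) x - T) := by
    intro i
    rw [Algebra.algebraMap_eq_smul_one]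
    simp [hT i, sub_smul]
  have hi := diagOp_isDiag e fun i => (x - μ i)⁻¹
  refine ⟨⟨_, diagOp e fun i => (x - μ i)⁻¹, ?_, ?_⟩, rfl⟩
  · refine ext_basis e fun i => ?_
    rw [(hd.mul hi) i]
    simp [mul_inv_cancel₀ (h1 i)]
  · refine ext_basis e fun i => ?_
    rw [(hi.mul hd) i]
    simp [inv_mul_cancel₀ (h1 i)]

lemma aeval (hT : IsDiag e μ T) (p : Polynomial ℝ) :
    IsDiag e (fun i => p.eval (μ i)) (Polynomial.aeval T p) := by
  induction p using Polynomial.induction_on with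
  | C a => intro i; simp [Algebra.algebraMap_eq_smul_one]
  | add p q hp hq => simpa using hp.add hq
  | monomial n a h => simpa [pow_succ, mul_assoc] using h.mul hT

variable [FiniteDimensional ℂ H]

lemma exists_of_isSelfAdjoint (hT : IsSelfAdjoint T) :
    ∃ (e : OrthonormalBasis (Fin (Module.finrank ℂ H)) ℂ H) (μ : _ → ℝ), IsDiag e μ T := by
  have h := ContinuousLinearMap.isSelfAdjoint_iff_isSymmetric.mp hT
  exact ⟨h.eigenvectorBasis rfl, h.eigenvalues rfl, h.apply_eigenvectorBasis rfl⟩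

lemma isSelfAdjoint (hT : IsDiag e μ T) : IsSelfAdjoint T := by
  rw [ContinuousLinearMap.isSelfAdjoint_iff_isSymmetric]
  rw [LinearMap.isSymmetric_iff_inner_map_self_real]
  intro v
  rw [ContinuousLinearMap.coe_coe, ← inner_conj_symm (T v) v, hT.inner_self]
  simp

lemma cfc (hT : IsDiag e μ T) (f : ℝ → ℝ) : IsDiag e (fun i => f (μ i)) (cfc f T) := by
  classical
  -- The spectrum lies in the finite set of the `μ i`, where `f` agrees with a polynomial; no
  -- continuity of `f` is needed.
  set p := Lagrange.interpolate (Finset.univ.image μ) id f with hp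
  have key : ∀ i, p.eval (μ i) = f (μ i) := fun i =>
    Lagrange.eval_interpolate_at_node (v := id) f (Function.injective_id.injOn) (by simp)
  have : _root_.cfc f T = Polynomial.aeval T p := by
    rw [← cfc_polynomial p T hT.isSelfAdjoint]
    refine cfc_congr fun x hx => ?_
    obtain ⟨i, rfl⟩ := hT.spectrum_subset hx
    exact (key i).symm
  rw [this]
  intro i
  rw [hT.aeval p i]
  simp only [key]

lemma log (hT : IsDiag e μ T) : IsDiag e (fun i => Real.log (μ i)) (CFC.log T) := hT.cfc _

lemma posPart (hT : IsDiag e μ T) : IsDiag e (fun i => max (μ i) 0) T⁺ := by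
  rw [CFC.posPart_def, cfcₙ_eq_cfc]
  exact hT.cfc _

end IsDiag

end QuantumDivergence

/-! ### Positive index of inertia -/

namespace QuantumDivergence

variable {H : Type*} [NormedAddCommGroup H] [InnerProductSpace ℂ H]
  {ι κ : Type*} [Fintype ι] [Fintype κ]

/-- The quadratic form of `T` is positive definite on the subspace `V`. -/
def PosOn (T : H →L[ℂ] H) (V : Submodule ℂ H) : Prop :=
  ∀ x ∈ V, x ≠ 0 → 0 < (inner ℂ x (T x)).re

/-- The positive index of inertia: the largest dimension of a subspace on which the quadratic form
of `T` is positive definite. -/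
noncomputable def posIndex (T : H →L[ℂ] H) : ℕ :=
  sSup {k | ∃ V : Submodule ℂ H, PosOn T V ∧ Module.finrank ℂ V = k}

variable [FiniteDimensional ℂ H]

/-- Without a bound, `sSup` on `ℕ` would default to `0`; with it the supremum is attained. -/
lemma bddAbove_finrank_posOn (T : H →L[ℂ] H) :
    BddAbove {k | ∃ V : Submodule ℂ H, PosOn T V ∧ Module.finrank ℂ V = k} := by
  refine ⟨Module.finrank ℂ H, ?_⟩
  rintro k ⟨V, -, rfl⟩
  exact V.finrank_le

lemma PosOn.le_posIndex {T : H →L[ℂ] H} {V : Submodule ℂ H} (h : PosOn T V) :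
    Module.finrank ℂ V ≤ posIndex T :=
  le_csSup (bddAbove_finrank_posOn T) ⟨V, h, rfl⟩

lemma exists_posOn (T : H →L[ℂ] H) :
    ∃ V : Submodule ℂ H, PosOn T V ∧ Module.finrank ℂ V = posIndex T := by
  have hne : {k | ∃ V : Submodule ℂ H, PosOn T V ∧ Module.finrank ℂ V = k}.Nonempty :=
    ⟨0, ⊥, fun x hx h0 => absurd hx h0, finrank_bot ℂ H⟩
  exact Nat.sSup_mem hne (bddAbove_finrank_posOn T)

/-- A subspace of larger dimension contains a nonzero vector whose coordinates at the positive
eigenvalues all vanish, and there the form is nonpositive. Conversely, the form is positive on the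
vectors whose other coordinates vanish. -/
lemma IsDiag.posIndex_eq {e : OrthonormalBasis ι ℂ H} {μ : ι → ℝ} {T : H →L[ℂ] H}
    (hT : IsDiag e μ T) : posIndex T = ∑ i, if 0 < μ i then 1 else 0 := by
  classical
  rw [Finset.sum_boole, Nat.cast_id, ← Fintype.card_subtype]
  let coord (p : ι → Prop) : H →ₗ[ℂ] ({i // p i} → ℂ) :=
    LinearMap.pi fun i => (innerSL ℂ (e i) : H →ₗ[ℂ] ℂ)
  have hcoord : ∀ (p : ι → Prop) (x : H) (i : {i // p i}), coord p x i = inner ℂ (e i) x :=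
    fun p x i => rfl
  apply le_antisymm
  · obtain ⟨V, hV, hk⟩ := exists_posOn T
    rw [← hk]
    by_contra! hlt
    have hker := LinearMap.ker_ne_bot_of_finrank_lt
      (f := (coord fun i => 0 < μ i).comp V.subtype) (by simpa using hlt)
    obtain ⟨x, hx, hx0⟩ := Submodule.exists_mem_ne_zero_of_ne_bot hker
    have hpos := hV x x.2 (by simpa using hx0)
    rw [hT.re_inner_self] at hpos
    refine absurd hpos (not_lt.mpr (Finset.sum_nonpos fun i _ => ?_))
    by_cases hi : 0 < μ i
    · have : inner ℂ (e i) (x : H) = 0 := congrFun (LinearMap.mem_ker.mp hx) ⟨i, hi⟩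
      simp [this]
    · exact mul_nonpos_of_nonpos_of_nonneg (not_lt.mp hi) (sq_nonneg _)
  · have hV : PosOn T (LinearMap.ker (coord fun i => ¬ 0 < μ i)) := by
      intro x hx hx0
      have hzero : ∀ i, ¬ 0 < μ i → inner ℂ (e i) x = 0 := fun i hi =>
        congrFun (LinearMap.mem_ker.mp hx) ⟨i, hi⟩
      rw [hT.re_inner_self]
      obtain ⟨i, hi⟩ : ∃ i, inner ℂ (e i) x ≠ 0 := by
        by_contra! h
        have := e.sum_sq_norm_inner_right x
        simp only [h, norm_zero] at this
        exact hx0 (by simpa using this.symm)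
      have hnn : ∀ j, 0 ≤ μ j * ‖inner ℂ (e j) x‖ ^ 2 := fun j => by
        by_cases hj : 0 < μ j
        · positivity
        · simp [hzero j hj]
      refine Finset.sum_pos' (fun j _ => hnn j) ⟨i, Finset.mem_univ i, ?_⟩
      have : 0 < μ i := by
        by_contra h
        exact hi (hzero i h)
      positivity
    refine le_trans ?_ hV.le_posIndex
    have h1 := LinearMap.finrank_range_add_finrank_ker (coord fun i => ¬ 0 < μ i)
    have h2 := Submodule.finrank_le (LinearMap.range (coord fun i => ¬ 0 < μ i))
    rw [Module.finrank_fintype_fun_eq_card] at h2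
    rw [Module.finrank_eq_card_basis e.toBasis] at h1
    have h3 := Fintype.card_subtype_compl fun i => 0 < μ i
    have h4 := Fintype.card_subtype_le fun i => 0 < μ i
    omega

/-- Sylvester's law of inertia. -/
lemma posIndex_congr {S T : H →L[ℂ] H} (P : H ≃ₗ[ℂ] H)
    (h : ∀ x, (inner ℂ x (S x)).re = (inner ℂ (P x) (T (P x))).re) : posIndex S = posIndex T := by
  have key : ∀ {S T : H →L[ℂ] H} (P : H ≃ₗ[ℂ] H),
      (∀ x, (inner ℂ x (S x)).re = (inner ℂ (P x) (T (P x))).re) → posIndex S ≤ posIndex T := by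
    intro S T P h
    obtain ⟨V, hV, hk⟩ := exists_posOn S
    rw [← hk, ← LinearEquiv.finrank_map_eq P V]
    refine PosOn.le_posIndex ?_
    rintro _ ⟨x, hx, rfl⟩ hx0
    have := hV x hx fun h0 => hx0 (by simp [h0])
    rw [h] at this
    exact this
  exact le_antisymm (key P h) (key P.symm fun x => by simp [h])

/-- Positivity on the compact unit sphere of a subspace persists under small perturbations of the
operator. This supplies the measurability needed for Tonelli. -/
lemma lowerSemicontinuous_posIndex :
    LowerSemicontinuous (posIndex : (H →L[ℂ] H) → ℕ) := by
  intro T k hk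
  obtain ⟨V, hV, hV'⟩ := exists_posOn T
  have hK : IsCompact ((V : Set H) ∩ Metric.sphere 0 1) :=
    (isCompact_sphere 0 1).inter_left V.closed_of_finiteDimensional
  have hev : ∀ᶠ S : H →L[ℂ] H in nhds T, ∀ x ∈ (V : Set H) ∩ Metric.sphere 0 1,
      0 < (inner ℂ x (S x)).re := by
    refine hK.eventually_forall_of_forall_eventually fun x hx => ?_
    have hc : Continuous fun p : (H →L[ℂ] H) × H => (inner ℂ p.2 (p.1 p.2)).re := by
      fun_prop
    refine hc.continuousAt.eventually (lt_mem_nhds ?_)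
    refine hV x hx.1 fun h0 => ?_
    simpa [h0] using hx.2
  filter_upwards [hev] with S hS
  refine hk.trans_le ?_
  rw [← hV']
  refine PosOn.le_posIndex fun x hx hx0 => ?_
  have hn : 0 < ‖x‖ := norm_pos_iff.mpr hx0
  have := hS (((‖x‖⁻¹ : ℝ) : ℂ) • x) ⟨V.smul_mem _ hx, by simp [norm_smul, hn.ne']⟩
  rw [map_smul, inner_smul_left, inner_smul_right, Complex.conj_ofReal, Complex.re_ofReal_mul,
    Complex.re_ofReal_mul] at this
  have h2 : 0 < ‖x‖⁻¹ := by positivity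
  exact (mul_pos_iff_of_pos_left h2).mp ((mul_pos_iff_of_pos_left h2).mp this)

/-- Integrating the positive index of `X - c u` over `u > 0` gives the trace of the positive part. -/
lemma lintegral_posIndex_sub_smul {X : H →L[ℂ] H} (hX : IsSelfAdjoint X) {c : ℝ} (hc : 0 < c) :
    ∫⁻ u in Set.Ioi (0 : ℝ), (posIndex (X - ((c * u : ℝ) : ℂ) • 1) : ENNReal)
      = ENNReal.ofReal ((tr X⁺).re / c) := by
  obtain ⟨e, μ, h⟩ := IsDiag.exists_of_isSelfAdjoint hX
  have hd : ∀ u : ℝ, IsDiag e (fun i => μ i - c * u) (X - ((c * u : ℝ) : ℂ) • 1) := by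
    intro u i
    simp [h i, sub_smul]
  -- The eigenvalue `μ i` is counted exactly for `u < μ i / c`, hence over a length `max (μ i) 0 /
  -- c` in `u > 0`.
  have hset : ∀ i, {u : ℝ | 0 < μ i - c * u} = Set.Iio (μ i / c) := by
    intro i
    ext u
    rw [Set.mem_ofPred, Set.mem_Iio, sub_pos, lt_div_iff₀ hc, mul_comm]
  have hterm : ∀ i, ∫⁻ u in Set.Ioi (0 : ℝ), (if 0 < μ i - c * u then 1 else 0 : ENNReal)
      = ENNReal.ofReal (max (μ i) 0 / c) := by
    intro i
    have : (fun u : ℝ => (if 0 < μ i - c * u then 1 else 0 : ENNReal))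
        = (Set.Iio (μ i / c)).indicator 1 := by
      rw [← hset]
      ext u
      simp [Set.indicator]
    rw [this, setLIntegral_indicator measurableSet_Iio, Set.inter_comm, Set.Ioi_inter_Iio]
    simp only [Pi.one_apply, setLIntegral_one, Real.volume_Ioo, sub_zero]
    rw [← max_div_div_right hc.le, zero_div]
    rcases le_total (μ i / c) 0 with h0 | h0 <;> simp [h0, ENNReal.ofReal_of_nonpos]
  simp_rw [fun u => (hd u).posIndex_eq, Nat.cast_sum, Nat.cast_ite, Nat.cast_one, Nat.cast_zero]
  rw [lintegral_finsetSum]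
  · simp_rw [hterm]
    rw [← ENNReal.ofReal_sum_of_nonneg fun i _ => by positivity, h.posPart.tr_eq,
      Complex.ofReal_re, Finset.sum_div]
  · intro i _
    exact Measurable.ite (by rw [hset]; exact measurableSet_Iio) measurable_const measurable_const

end QuantumDivergence

/-! ### Generalized eigenvalues of a pair -/

namespace QuantumDivergence

variable {H : Type*} [NormedAddCommGroup H] [InnerProductSpace ℂ H]
  {ι κ : Type*} [Fintype ι] [Fintype κ]

lemma sum_overlap_left (e : OrthonormalBasis ι ℂ H) (f : OrthonormalBasis κ ℂ H) (x : ι → ℝ) :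
    ∑ i, ∑ j, ‖inner ℂ (f j) (e i)‖ ^ 2 * x i = ∑ i, x i := by
  refine Finset.sum_congr rfl fun i _ => ?_
  rw [← Finset.sum_mul, f.sum_sq_norm_inner_right]
  simp

lemma sum_overlap_right (e : OrthonormalBasis ι ℂ H) (f : OrthonormalBasis κ ℂ H) (y : κ → ℝ) :
    ∑ i, ∑ j, ‖inner ℂ (f j) (e i)‖ ^ 2 * y j = ∑ j, y j := by
  rw [Finset.sum_comm]
  simp_rw [norm_inner_symm (f _) (e _)]
  exact sum_overlap_left f e y

lemma IsDiag.pos_of_isPosDef {e : OrthonormalBasis ι ℂ H} {μ : ι → ℝ} {T : H →L[ℂ] H}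
    [FiniteDimensional ℂ H] (hT : IsDiag e μ T) (h : IsPosDef T) (i : ι) : 0 < μ i := by
  have := h.2 (e i) (e.orthonormal.ne_zero i)
  rw [hT.inner_apply] at this
  simpa using this

variable [FiniteDimensional ℂ H]

/-- Simultaneous reduction of a pair of positive definite operators: the generalized eigenvalues
`m` of `A` relative to `B`. -/
lemma exists_pencil_eigenvalues {e : OrthonormalBasis ι ℂ H} {a : ι → ℝ} {A : H →L[ℂ] H}
    {f : OrthonormalBasis κ ℂ H} {b : κ → ℝ} {B : H →L[ℂ] H} (hA : IsDiag e a A)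
    (hB : IsDiag f b B) (ha : ∀ i, 0 < a i) (hb : ∀ j, 0 < b j) :
    ∃ m : Fin (Module.finrank ℂ H) → ℝ, (∀ k, 0 < m k) ∧
      (∀ c d : ℝ, posIndex ((c : ℂ) • A + (d : ℂ) • B) = ∑ k, if 0 < c * m k + d then 1 else 0) ∧
      ∑ k, m k = ∑ i, ∑ j, ‖inner ℂ (f j) (e i)‖ ^ 2 * (a i / b j) ∧
      ∑ k, Real.log (m k) = ∑ i, Real.log (a i) - ∑ j, Real.log (b j) := by
  -- `P` is `B^(-1/2)` and `Q` is its inverse; the `m k` will be the eigenvalues of `P * A * P`.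
  set P := diagOp f fun j => (Real.sqrt (b j))⁻¹ with hPdef
  set Q := diagOp f fun j => Real.sqrt (b j) with hQdef
  have hP : IsDiag f _ P := diagOp_isDiag f _
  have hQ : IsDiag f _ Q := diagOp_isDiag f _
  have hs : ∀ j, 0 < Real.sqrt (b j) := fun j => Real.sqrt_pos.mpr (hb j)
  have hss : ∀ j, Real.sqrt (b j) * Real.sqrt (b j) = b j := fun j =>
    Real.mul_self_sqrt (hb j).le
  have hPQ : P * Q = 1 := ext_basis f fun j => by
    rw [(hP.mul hQ) j]; simp [inv_mul_cancel₀ (hs j).ne']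
  have hQP : Q * P = 1 := ext_basis f fun j => by
    rw [(hQ.mul hP) j]; simp [mul_inv_cancel₀ (hs j).ne']
  have hPBP : P * B * P = 1 := ext_basis f fun j => by
    rw [((hP.mul hB).mul hP) j]
    have : (Real.sqrt (b j))⁻¹ * b j * (Real.sqrt (b j))⁻¹ = 1 := by
      have := (hs j).ne'
      nth_rw 2 [← hss j]
      field_simp
    simp only [this]
    simp
  have hPP : IsDiag f (fun j => (b j)⁻¹) (P * P) := by
    intro j
    rw [(hP.mul hP) j]
    simp only [← mul_inv, hss]
  have hPsa : IsSelfAdjoint P := hP.isSelfAdjoint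
  have hMsa : IsSelfAdjoint (P * A * P) := by
    have := hA.isSelfAdjoint.conjugate P
    rwa [hPsa.star_eq] at this
  obtain ⟨g, m, hg⟩ := IsDiag.exists_of_isSelfAdjoint hMsa
  let PE : H ≃ₗ[ℂ] H := LinearEquiv.ofLinearMap (P : H →ₗ[ℂ] H) (Q : H →ₗ[ℂ] H)
    (by ext x; exact congrArg (fun T : H →L[ℂ] H => T x) hPQ)
    (by ext x; exact congrArg (fun T : H →L[ℂ] H => T x) hQP)
  have hind : ∀ c d : ℝ,
      posIndex ((c : ℂ) • A + (d : ℂ) • B) = ∑ k, if 0 < c * m k + d then 1 else 0 := by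
    intro c d
    have hd : IsDiag g (fun k => c * m k + d) (P * ((c : ℂ) • A + (d : ℂ) • B) * P) := by
      have : P * ((c : ℂ) • A + (d : ℂ) • B) * P = (c : ℂ) • (P * A * P) + (d : ℂ) • 1 := by
        rw [← hPBP]
        simp only [mul_add, add_mul, mul_smul_comm, smul_mul_assoc]
      rw [this]
      intro k
      rw [add_apply, smul_apply, hg k, smul_smul,
        smul_apply]
      push_cast
      rw [add_smul]
      rfl
    rw [← hd.posIndex_eq]
    refine (posIndex_congr PE fun x => ?_).symm
    have := ContinuousLinearMap.isSelfAdjoint_iff_isSymmetric.mp hPsa x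
      (((c : ℂ) • A + (d : ℂ) • B) (P x))
    exact congrArg Complex.re this.symm
  -- At `c = 1`, `d = 0` the index of `A` is the full dimension, so every `m k` is counted.
  have hmpos : ∀ k, 0 < m k := by
    have h1 := hind 1 0
    rw [show ((1 : ℝ) : ℂ) • A + ((0 : ℝ) : ℂ) • B = A by simp, hA.posIndex_eq] at h1
    simp only [ha, if_true, one_mul, add_zero, Finset.sum_boole, Finset.sum_const, smul_eq_mul,
      mul_one, Nat.cast_id] at h1
    have h2 : Fintype.card ι = Fintype.card (Fin (Module.finrank ℂ H)) := by
      rw [Fintype.card_fin, Module.finrank_eq_card_basis e.toBasis]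
    rw [Finset.card_univ, h2, ← Finset.card_univ] at h1
    have h3 := Finset.card_filter_eq_iff.mp h1.symm
    exact fun k => h3 k (Finset.mem_univ k)
  refine ⟨m, hmpos, hind, ?_, ?_⟩
  · have h1 : tr (P * A * P) = tr (A * (P * P)) := by
      rw [mul_assoc]
      change LinearMap.trace ℂ H ((P : H →ₗ[ℂ] H) * ((A * P : H →L[ℂ] H) : H →ₗ[ℂ] H)) = _
      rw [LinearMap.trace_mul_comm]
      rfl
    rw [hg.tr_eq, hA.tr_mul hPP] at h1
    simpa only [div_eq_mul_inv] using Complex.ofReal_injective h1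
  · have h1 : LinearMap.det (P * A * P : H →L[ℂ] H).toLinearMap
        = LinearMap.det (A : H →ₗ[ℂ] H) * LinearMap.det (P * P : H →L[ℂ] H).toLinearMap := by
      change LinearMap.det ((P : H →ₗ[ℂ] H) * (A : H →ₗ[ℂ] H) * (P : H →ₗ[ℂ] H))
        = _ * LinearMap.det ((P : H →ₗ[ℂ] H) * (P : H →ₗ[ℂ] H))
      simp only [map_mul]
      ring
    rw [hg.det_eq, hA.det_eq, hPP.det_eq, ← Complex.ofReal_mul] at h1
    have h2 := congrArg Real.log (Complex.ofReal_injective h1)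
    rw [Real.log_prod fun k _ => (hmpos k).ne', Real.log_mul, Real.log_prod fun i _ => (ha i).ne',
      Real.log_prod fun j _ => inv_ne_zero (hb j).ne'] at h2
    · simpa [Real.log_inv, sub_eq_add_neg] using h2
    · exact (Finset.prod_pos fun i _ => ha i).ne'
    · exact (Finset.prod_pos fun j _ => inv_pos.mpr (hb j)).ne'

/-- Layer-cake representation of `Tr f(M)`, where `f x = x - 1 - log x` and `M` is a positive
operator with the generalized eigenvalues of `A` relative to `B`. -/
lemma lintegral_posIndex_pencil {e : OrthonormalBasis ι ℂ H} {a : ι → ℝ} {A : H →L[ℂ] H}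
    {f : OrthonormalBasis κ ℂ H} {b : κ → ℝ} {B : H →L[ℂ] H} (hA : IsDiag e a A)
    (hB : IsDiag f b B) (ha : ∀ i, 0 < a i) (hb : ∀ j, 0 < b j) :
    ∫⁻ t in Set.Ioi (1 : ℝ),
        (ENNReal.ofReal (1 - t⁻¹) * (posIndex (A - (t : ℂ) • B) : ENNReal)
          + ENNReal.ofReal (t⁻¹ - (t ^ 2)⁻¹) * (posIndex (B - (t : ℂ) • A) : ENNReal))
      = ENNReal.ofReal (∑ i, ∑ j, ‖inner ℂ (f j) (e i)‖ ^ 2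
          * (a i / b j - 1 - Real.log (a i / b j))) := by
  obtain ⟨m, hm, hind, hsum, hlog⟩ := exists_pencil_eigenvalues hA hB ha hb
  have h1 : ∀ t : ℝ, posIndex (A - (t : ℂ) • B) = ∑ k, if t < m k then 1 else 0 := by
    intro t
    have := hind 1 (-t)
    simpa [← sub_eq_add_neg] using this
  have h2 : ∀ t : ℝ, posIndex (B - (t : ℂ) • A) = ∑ k, if t * m k < 1 then 1 else 0 := by
    intro t
    have := hind (-t) 1
    simpa [sub_eq_add_neg, add_comm, ← lt_neg_add_iff_lt] using this
  -- The squared overlaps are doubly stochastic, so both sides reduce to the same trace, dimension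
  -- and log-determinants.
  have h3 : ∑ i, ∑ j, ‖inner ℂ (f j) (e i)‖ ^ 2 * (a i / b j - 1 - Real.log (a i / b j))
      = ∑ k, (m k - 1 - Real.log (m k)) := by
    have hcard : ∑ i, ∑ j, ‖inner ℂ (f j) (e i)‖ ^ 2 * (1 : ℝ)
        = ∑ _k : Fin (Module.finrank ℂ H), (1 : ℝ) := by
      rw [sum_overlap_left e f fun _ => 1]
      simp [Module.finrank_eq_card_basis e.toBasis]
    simp_rw [fun i j => Real.log_div (ha i).ne' (hb j).ne', mul_sub, Finset.sum_sub_distrib]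
    rw [sum_overlap_left e f fun i => Real.log (a i), sum_overlap_right e f fun j => Real.log (b j),
      hcard, hsum, hlog]
  rw [h3, ENNReal.ofReal_sum_of_nonneg fun k _ => sub_one_sub_log_nonneg (hm k)]
  simp_rw [← lintegral_layer_cake_entropy (hm _)]
  rw [← lintegral_finsetSum]
  · refine lintegral_congr fun t => ?_
    rw [h1, h2]
    push_cast
    rw [Finset.mul_sum, Finset.mul_sum, ← Finset.sum_add_distrib]
    simp
  · intro k _
    refine Measurable.add (Measurable.ite measurableSet_Iio (by fun_prop) measurable_const)
      (Measurable.ite (measurableSet_lt (by fun_prop) (by fun_prop)) (by fun_prop) measurable_const)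

end QuantumDivergence

/-! ### The double integral -/

namespace QuantumDivergence

variable {H : Type*} [NormedAddCommGroup H] [InnerProductSpace ℂ H]
  {ι κ : Type*} [Fintype ι] [Fintype κ] [FiniteDimensional ℂ H]

lemma isSelfAdjoint_sub_smul {A B : H →L[ℂ] H} (hA : IsSelfAdjoint A) (hB : IsSelfAdjoint B)
    (γ : ℝ) : IsSelfAdjoint (A - (γ : ℂ) • B) := by
  refine hA.sub ?_
  rw [IsSelfAdjoint, star_smul, hB.star_eq, Complex.star_def, Complex.conj_ofReal]

lemma hockeyStick_nonneg {A B : H →L[ℂ] H} (hA : IsSelfAdjoint A) (hB : IsSelfAdjoint B) (γ : ℝ) :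
    0 ≤ hockeyStick γ A B := by
  obtain ⟨e, μ, h⟩ := IsDiag.exists_of_isSelfAdjoint (isSelfAdjoint_sub_smul hA hB γ)
  rw [hockeyStick, h.posPart.tr_eq, Complex.ofReal_re]
  exact Finset.sum_nonneg fun i _ => le_max_right _ _

lemma measurable_posIndex_pencil (A B : H →L[ℂ] H) :
    Measurable fun p : ℝ × ℝ =>
      (posIndex (A - (p.1 : ℂ) • B - (((p.1 - 1) * p.2 : ℝ) : ℂ) • 1) : ENNReal) := by
  have hc : Continuous fun p : ℝ × ℝ =>
      A - (p.1 : ℂ) • B - (((p.1 - 1) * p.2 : ℝ) : ℂ) • (1 : H →L[ℂ] H) := by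
    fun_prop
  have hl : LowerSemicontinuous fun p : ℝ × ℝ =>
      posIndex (A - (p.1 : ℂ) • B - (((p.1 - 1) * p.2 : ℝ) : ℂ) • 1) :=
    fun p k hk => hc.continuousAt.eventually (lowerSemicontinuous_posIndex _ k hk)
  exact (measurable_from_top (f := fun n : ℕ => (n : ENNReal))).comp hl.measurable

lemma lintegral_posIndex_shift {A B : H →L[ℂ] H} (hA : IsSelfAdjoint A) (hB : IsSelfAdjoint B)
    {t : ℝ} (ht : 1 < t) :
    ∫⁻ u in Set.Ioi (0 : ℝ),
        (posIndex (A - (t : ℂ) • B - (((t - 1) * u : ℝ) : ℂ) • 1) : ENNReal)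
      = ENNReal.ofReal (hockeyStick t A B / (t - 1)) :=
  lintegral_posIndex_sub_smul (isSelfAdjoint_sub_smul hA hB t) (sub_pos.mpr ht)

lemma aemeasurable_hockeyStick {A B : H →L[ℂ] H} (hA : IsSelfAdjoint A) (hB : IsSelfAdjoint B) :
    AEMeasurable (fun t => hockeyStick t A B) (volume.restrict (Set.Ioi 1)) := by
  -- For `t > 1` the divergence is `t - 1` times an integral of the jointly measurable index.
  have h1 : Measurable fun t : ℝ => (t - 1) * (∫⁻ u in Set.Ioi (0 : ℝ),
      (posIndex (A - (t : ℂ) • B - (((t - 1) * u : ℝ) : ℂ) • 1) : ENNReal)).toReal :=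
    Measurable.mul (by fun_prop)
      (measurable_posIndex_pencil A B).lintegral_prod_right'.ennreal_toReal
  refine h1.aemeasurable.congr ?_
  filter_upwards [ae_restrict_mem measurableSet_Ioi] with t ht
  have ht' : 0 < t - 1 := sub_pos.mpr ht
  rw [lintegral_posIndex_shift hA hB ht,
    ENNReal.toReal_ofReal (div_nonneg (hockeyStick_nonneg hA hB t) ht'.le),
    mul_div_cancel₀ _ ht'.ne']

lemma IsDiag.relativeEntropy_sub_eq {e : OrthonormalBasis ι ℂ H} {a : ι → ℝ} {A : H →L[ℂ] H}
    {f : OrthonormalBasis κ ℂ H} {b : κ → ℝ} {B : H →L[ℂ] H} (hA : IsDiag e a A)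
    (hB : IsDiag f b B) :
    relativeEntropy A B - (tr (A - B)).re = ∑ i, ∑ j, ‖inner ℂ (f j) (e i)‖ ^ 2
      * (a i * (Real.log (a i) - Real.log (b j)) - a i + b j) := by
  have h1 : tr (A * (CFC.log A - CFC.log B)) = tr (A * CFC.log A) - tr (A * CFC.log B) := by
    rw [mul_sub]
    exact map_sub (LinearMap.trace ℂ H) _ _
  have h2 : tr (A - B) = tr A - tr B := map_sub (LinearMap.trace ℂ H) _ _
  rw [relativeEntropy, h1, h2, (hA.mul hA.log).tr_eq, hA.tr_mul hB.log, hA.tr_eq, hB.tr_eq]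
  simp only [Complex.sub_re, Complex.ofReal_re]
  simp_rw [mul_sub, mul_add, mul_sub, Finset.sum_add_distrib, Finset.sum_sub_distrib]
  rw [sum_overlap_left e f fun i => a i * Real.log (a i), sum_overlap_left e f a,
    sum_overlap_right e f b]
  ring

/-- The integrand of the double integral which links the hockey-stick divergences (integrate over
the shift `u` first) to the relative entropy (integrate over the level `t` first). -/
noncomputable def layer (A B : H →L[ℂ] H) (t u : ℝ) : ENNReal :=
  ENNReal.ofReal (1 - t⁻¹)
      * (posIndex (A - (t : ℂ) • B - (((t - 1) * u : ℝ) : ℂ) • 1) : ENNReal)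
    + ENNReal.ofReal (t⁻¹ - (t ^ 2)⁻¹)
      * (posIndex (B - (t : ℂ) • A - (((t - 1) * u : ℝ) : ℂ) • 1) : ENNReal)

lemma measurable_layer (A B : H →L[ℂ] H) : Measurable (Function.uncurry (layer A B)) :=
  (Measurable.mul (by fun_prop) (measurable_posIndex_pencil A B)).add
    (Measurable.mul (by fun_prop) (measurable_posIndex_pencil B A))

/-- The weights are `(t - 1) / t` and `(t - 1) / t²`, so the denominators `t - 1` cancel. -/
lemma lintegral_weighted_add {g h : ℝ → ENNReal} (hg : Measurable g) (hh : Measurable h)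
    {t x y : ℝ} (ht : 1 < t) (hx : 0 ≤ x) (hy : 0 ≤ y)
    (hgx : ∫⁻ u in Set.Ioi (0 : ℝ), g u = ENNReal.ofReal (x / (t - 1)))
    (hhy : ∫⁻ u in Set.Ioi (0 : ℝ), h u = ENNReal.ofReal (y / (t - 1))) :
    ∫⁻ u in Set.Ioi (0 : ℝ),
        (ENNReal.ofReal (1 - t⁻¹) * g u + ENNReal.ofReal (t⁻¹ - (t ^ 2)⁻¹) * h u)
      = ENNReal.ofReal (t⁻¹ * x + (t ^ 2)⁻¹ * y) := by
  have ht0 : 0 < t := by linarith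
  have hs : t - 1 ≠ 0 := by linarith
  have hw1 : 0 ≤ 1 - t⁻¹ := by linarith [inv_le_one_of_one_le₀ ht.le]
  have hw2 : 0 ≤ t⁻¹ - (t ^ 2)⁻¹ := by
    linarith [inv_anti₀ ht0 (by nlinarith : t ≤ t ^ 2)]
  rw [lintegral_add_left (hg.const_mul _), lintegral_const_mul _ hg, lintegral_const_mul _ hh,
    hgx, hhy, ← ENNReal.ofReal_mul hw1, ← ENNReal.ofReal_mul hw2, ← ENNReal.ofReal_add]
  · congr 1
    field_simp
  · exact mul_nonneg hw1 (div_nonneg hx (sub_nonneg.mpr ht.le))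
  · exact mul_nonneg hw2 (div_nonneg hy (sub_nonneg.mpr ht.le))

lemma lintegral_layer_shift {A B : H →L[ℂ] H} (hA : IsSelfAdjoint A) (hB : IsSelfAdjoint B)
    {t : ℝ} (ht : 1 < t) :
    ∫⁻ u in Set.Ioi (0 : ℝ), layer A B t u
      = ENNReal.ofReal (t⁻¹ * hockeyStick t A B + (t ^ 2)⁻¹ * hockeyStick t B A) :=
  lintegral_weighted_add ((measurable_posIndex_pencil A B).comp measurable_prodMk_left)
    ((measurable_posIndex_pencil B A).comp measurable_prodMk_left) ht (hockeyStick_nonneg hA hB t)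
    (hockeyStick_nonneg hB hA t) (lintegral_posIndex_shift hA hB ht)
    (lintegral_posIndex_shift hB hA ht)

lemma lintegral_layer_level {e : OrthonormalBasis ι ℂ H} {a : ι → ℝ} {A : H →L[ℂ] H}
    {f : OrthonormalBasis κ ℂ H} {b : κ → ℝ} {B : H →L[ℂ] H} (hA : IsDiag e a A)
    (hB : IsDiag f b B) (ha : ∀ i, 0 < a i) (hb : ∀ j, 0 < b j) {u : ℝ} (hu : 0 < u) :
    ∫⁻ t in Set.Ioi (1 : ℝ), layer A B t u
      = ∑ i, ∑ j, ENNReal.ofReal (‖inner ℂ (f j) (e i)‖ ^ 2)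
          * ENNReal.ofReal ((a i + u) / (b j + u) - 1 - Real.log ((a i + u) / (b j + u))) := by
  have hpos : ∀ i j,
      0 ≤ (a i + u) / (b j + u) - 1 - Real.log ((a i + u) / (b j + u)) := fun i j =>
    sub_one_sub_log_nonneg (div_pos (add_pos (ha i) hu) (add_pos (hb j) hu))
  -- The factor `t - 1` in the shift is what makes it a shift of both operators by `u`.
  have hshift : ∀ (X Y : H →L[ℂ] H) (t : ℝ), X - (t : ℂ) • Y - (((t - 1) * u : ℝ) : ℂ) • 1
      = (X + (u : ℂ) • 1) - (t : ℂ) • (Y + (u : ℂ) • 1) := by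
    intro X Y t
    push_cast
    module
  have key := lintegral_posIndex_pencil (hA.add (IsDiag.smul_one e u))
    (hB.add (IsDiag.smul_one f u)) (fun i => add_pos (ha i) hu) (fun j => add_pos (hb j) hu)
  simp_rw [layer, hshift]
  rw [key, ENNReal.ofReal_sum_of_nonneg fun i _ =>
    Finset.sum_nonneg fun j _ => mul_nonneg (sq_nonneg _) (hpos i j)]
  refine Finset.sum_congr rfl fun i _ => ?_
  rw [ENNReal.ofReal_sum_of_nonneg fun j _ => mul_nonneg (sq_nonneg _) (hpos i j)]
  exact Finset.sum_congr rfl fun j _ => ENNReal.ofReal_mul (sq_nonneg _)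

/-- The integral of the hockey-stick divergences, with values in `[0, ∞]`. -/
lemma lintegral_hockeyStick {A B : H →L[ℂ] H} (hA : IsPosDef A) (hB : IsPosDef B) :
    ∫⁻ t in Set.Ioi (1 : ℝ),
        ENNReal.ofReal (t⁻¹ * hockeyStick t A B + (t ^ 2)⁻¹ * hockeyStick t B A)
      = ENNReal.ofReal (relativeEntropy A B - (tr (A - B)).re) := by
  obtain ⟨e, a, hAd⟩ := IsDiag.exists_of_isSelfAdjoint hA.1
  obtain ⟨f, b, hBd⟩ := IsDiag.exists_of_isSelfAdjoint hB.1
  have ha := hAd.pos_of_isPosDef hA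
  have hb := hBd.pos_of_isPosDef hB
  have hm : ∀ i j, Measurable fun u : ℝ =>
      ENNReal.ofReal ((a i + u) / (b j + u) - 1 - Real.log ((a i + u) / (b j + u))) :=
    fun i j => by fun_prop
  -- Tonelli exchanges shift and level; afterwards each pair of eigenvalues leaves a scalar integral
  -- in `u`.
  rw [← setLIntegral_congr_fun measurableSet_Ioi fun t ht => lintegral_layer_shift hA.1 hB.1 ht,
    lintegral_lintegral_swap (measurable_layer A B).aemeasurable,
    setLIntegral_congr_fun measurableSet_Ioi fun u hu =>
      lintegral_layer_level hAd hBd ha hb hu,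
    lintegral_finsetSum _ fun i _ => Finset.measurable_fun_sum _ fun j _ => (hm i j).const_mul _,
    hAd.relativeEntropy_sub_eq hBd, ENNReal.ofReal_sum_of_nonneg fun i _ =>
      Finset.sum_nonneg fun j _ => mul_nonneg (sq_nonneg _) (scalar_entropy_nonneg (ha i) (hb j))]
  refine Finset.sum_congr rfl fun i _ => ?_
  rw [lintegral_finsetSum _ fun j _ => (hm i j).const_mul _,
    ENNReal.ofReal_sum_of_nonneg fun j _ => mul_nonneg (sq_nonneg _) (scalar_entropy_nonneg (ha i) (hb j))]
  refine Finset.sum_congr rfl fun j _ => ?_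
  rw [lintegral_const_mul _ (hm i j), lintegral_shift_entropy (ha i) (hb j),
    ENNReal.ofReal_mul (sq_nonneg _)]

lemma relativeEntropy_sub_tr_nonneg {A B : H →L[ℂ] H} (hA : IsPosDef A) (hB : IsPosDef B) :
    0 ≤ relativeEntropy A B - (tr (A - B)).re := by
  obtain ⟨e, a, hAd⟩ := IsDiag.exists_of_isSelfAdjoint hA.1
  obtain ⟨f, b, hBd⟩ := IsDiag.exists_of_isSelfAdjoint hB.1
  rw [hAd.relativeEntropy_sub_eq hBd]
  exact Finset.sum_nonneg fun i _ => Finset.sum_nonneg fun j _ => mul_nonneg (sq_nonneg _)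
    (scalar_entropy_nonneg (hAd.pos_of_isPosDef hA i) (hBd.pos_of_isPosDef hB j))

end QuantumDivergence

theorem proposition4p2 {H : Type*} [NormedAddCommGroup H] [InnerProductSpace ℂ H]
    [FiniteDimensional ℂ H] (A B : H →L[ℂ] H)
    (hA : QuantumDivergence.IsPosDef A) (hB : QuantumDivergence.IsPosDef B) :
    MeasureTheory.IntegrableOn
        (fun γ : ℝ => γ⁻¹ * QuantumDivergence.hockeyStick γ A B
          + (γ ^ 2)⁻¹ * QuantumDivergence.hockeyStick γ B A) (Set.Ioi 1) ∧
      QuantumDivergence.relativeEntropy A B =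
        (∫ γ in Set.Ioi (1 : ℝ), (γ⁻¹ * QuantumDivergence.hockeyStick γ A B
          + (γ ^ 2)⁻¹ * QuantumDivergence.hockeyStick γ B A))
        + (QuantumDivergence.tr (A - B)).re := by
  have hmeas : AEStronglyMeasurable (fun γ : ℝ => γ⁻¹ * hockeyStick γ A B
      + (γ ^ 2)⁻¹ * hockeyStick γ B A) (volume.restrict (Set.Ioi 1)) := by
    refine AEMeasurable.aestronglyMeasurable (AEMeasurable.add ?_ ?_)
    · exact AEMeasurable.mul (by fun_prop) (aemeasurable_hockeyStick hA.1 hB.1)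
    · exact AEMeasurable.mul (by fun_prop) (aemeasurable_hockeyStick hB.1 hA.1)
  have hnn : 0 ≤ᵐ[volume.restrict (Set.Ioi 1)] fun γ : ℝ => γ⁻¹ * hockeyStick γ A B
      + (γ ^ 2)⁻¹ * hockeyStick γ B A := by
    filter_upwards [ae_restrict_mem measurableSet_Ioi] with γ hγ
    have hγ0 : (0 : ℝ) < γ := lt_trans one_pos hγ
    have hEA := hockeyStick_nonneg hA.1 hB.1 γ
    have hEB := hockeyStick_nonneg hB.1 hA.1 γ
    positivity
  -- For a nonnegative integrand, this finite value gives both absolute convergence and the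
  -- identity.
  have hint := lintegral_hockeyStick hA hB
  refine ⟨⟨hmeas, ?_⟩, ?_⟩
  · rw [hasFiniteIntegral_iff_ofReal hnn, hint]
    exact ENNReal.ofReal_lt_top
  · rw [integral_eq_lintegral_of_nonneg_ae hnn hmeas, hint,
      ENNReal.toReal_ofReal (relativeEntropy_sub_tr_nonneg hA hB)]
    ring
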